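/- Let $\mathcal C=\{0,1\}^{\mathbb N}$ be the binary Cantor set, and regard $\mathcal C\times\mathcal C$ as the unit square (binary expansions of the two coordinates). For finite binary words $u,v$ the dyadic rectangle $[u,v]$ is $u\mathcal C\times v\mathcal C$. The group $2V$ consists of all bijections $g$ of $\mathcal C\times\mathcal C$ for which there are two partitions of the square into finitely many dyadic rectangles and a bijection $[u_i,v_i]\mapsto[u_i',v_i']$ between their rectangles with $g(u_ix,v_iy)=(u_i'x,v_i'y)$ for all $x,y\in\mathcal C$ and all $i$. The vertical copy of $V$ in $2V$ consists of the elements for which both partitions can be chosen with vertical subdivisions only, i.e. with all $v_i,v_i'$ empty; the vertical copies of $T$ and of $F$ consist of those elements of the vertical copy of $V$ which preserve, respectively, the left-to-right cyclic order and the left-to-right (lexicographic) order of the first coordinates. Let $C_0\in 2V$ be $(bx,y)\mapsto(x,by)$ for $b\in\{0,1\}$, and let $X_0$ be the element of the vertical copy of $F$ which acts on the first coordinate by $0t\mapsto 00t$, $10t\mapsto 01t$, $11t\mapsto 1t$. Put $w_n=C_0^{-n}X_0C_0^n$ for $n\ge 0$, where products are compositions and the right factor acts first. For a subset $S$ of a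 group let $|g|_S$ be the least length of a word in $S\cup S^{-1}$ representing $g$ ($\infty$ if there is none). **Theorem 5.1 (distortion).** 1. The vertical copies of $F$, $T$ and $V$ are at least exponentially distorted in $2V$: if $H$ is any of these three subgroups, $S$ is any finite generating set of $2V$ and $A$ is any finite generating set of $H$, then there is $a>1$ such that for all sufficiently large $n$ $$\sup\{|h|_A : h\in H,\ |h|_S\le n\}\ \ge\ a^n .$$ 2. For every $n\ge 0$: $|w_n|_S\le 2n+1$ for every subset $S$ of $2V$ (in particular for every generating set) that contains $C_0$ and $X_0$; moreover $w_n$ lies in the vertical copy of $F$, and the number $N(w_n)$ of carets in each tree of a minimal tree-pair diagram of $w_n$ as an element of $F$ (two finite rooted binary trees with only vertical carets and equally many leaves, such that $w_n$ maps the strip over the $i$-th leaf of the first tree affinely onto the strip over the $i$-th leaf of the second, for every $i$) satisfies $2^n\le N(w_n)\le 3\cdot 2^n$. 3. The length of $w_n$ in the vertical subgroups is exponential: for every finite subset $A$ of the vertical copy of $V$ (in particular, for every finite generating set of the vertical copy of $F$, $T$ or $V$) there is $c>0$ such that $|w_n|_A\ge c\,2^n$ for all $n\ge 0$. -/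

import Mathlib

open Filter
open scoped ENNReal

/-! ### Dyadic subdivisions of the square

The square is the product of two binary Cantor sets: a point is a pair of infinite binary
expansions. A dyadic rectangle is a pair of finite binary words, the first one naming a dyadic
interval on the horizontal axis and the second one a dyadic interval on the vertical axis. -/

/-- The square, as pairs of infinite binary sequences. -/
abbrev Square : Type := Stream' Bool × Stream' Bool

/-- A dyadic rectangle, given by the binary words of its two sides. -/
abbrev Rect : Type := List Bool × List Bool

/-- The canonical affine parametrization of a dyadic rectangle by the whole square. -/
def Rect.embed (r : Rect) (z : Square) : Square :=
  (Stream'.appendStream' r.1 z.1, Stream'.appendStream' r.2 z.2)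

/-- The set of points of a dyadic rectangle. -/
def Rect.region (r : Rect) : Set Square := Set.range r.embed

/-- A dyadic subdivision: finitely many dyadic rectangles which partition the square. -/
def IsSubdivision (D : Finset Rect) : Prop :=
  ∀ x : Square, ∃! r : Rect, r ∈ D ∧ x ∈ r.region

/-- A subdivision that uses vertical subdivisions only, i.e. a partition into dyadic
strips `I × [0,1]`. -/
def IsVertical (D : Finset Rect) : Prop := ∀ r ∈ D, r.2 = []

/-- The bijection `g` maps the rectangles of the subdivision `D` affinely onto those of the
subdivision `R`, according to some bijection `σ` between the rectangles. -/
def IsRepresentedBy (D R : Finset Rect) (g : Equiv.Perm Square) : Prop :=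
  IsSubdivision D ∧ IsSubdivision R ∧
    ∃ σ : D ≃ R, ∀ (r : D) (z : Square), g (r.1.embed z) = (σ r).1.embed z

lemma embed_injective (r : Rect) : Function.Injective r.embed := by
  intro z w h
  have h1 := congrArg Prod.fst h
  have h2 := congrArg Prod.snd h
  exact Prod.ext (Stream'.append_right_injective _ _ _ h1)
    (Stream'.append_right_injective _ _ _ h2)

lemma embed_embed (r s : Rect) (z : Square) :
    r.embed (s.embed z) = Rect.embed (r.1 ++ s.1, r.2 ++ s.2) z := by
  simp [Rect.embed, Stream'.append_append_stream]

/-- The `2^N × 2^M` grid. -/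
def grid (N M : ℕ) : Finset Rect :=
  (Finset.univ.image (List.ofFn : (Fin N → Bool) → List Bool)) ×ˢ
    (Finset.univ.image (List.ofFn : (Fin M → Bool) → List Bool))

lemma mem_words (N : ℕ) (l : List Bool) :
    l ∈ Finset.univ.image (List.ofFn : (Fin N → Bool) → List Bool) ↔ l.length = N := by
  constructor
  · intro h
    obtain ⟨f, -, rfl⟩ := Finset.mem_image.1 h
    simp
  · rintro rfl
    exact Finset.mem_image.2 ⟨l.get, Finset.mem_univ _, List.ofFn_get l⟩

lemma mem_grid (N M : ℕ) (r : Rect) : r ∈ grid N M ↔ r.1.length = N ∧ r.2.length = M := by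
  rw [grid, Finset.mem_product, mem_words, mem_words]

lemma embed_take_drop (N M : ℕ) (x : Square) :
    Rect.embed (x.1.take N, x.2.take M) (x.1.drop N, x.2.drop M) = x := by
  simp [Rect.embed, Stream'.append_take_drop]

lemma grid_unique {N M : ℕ} {r s : Rect} (hr : r ∈ grid N M) (hs : s ∈ grid N M) {z w : Square}
    (h : r.embed z = s.embed w) : r = s := by
  rw [mem_grid] at hr hs
  exact Prod.ext
    (Stream'.append_left_injective _ _ _ _ (congrArg Prod.fst h) (hr.1.trans hs.1.symm))
    (Stream'.append_left_injective _ _ _ _ (congrArg Prod.snd h) (hr.2.trans hs.2.symm))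

lemma isSubdivision_grid (N M : ℕ) : IsSubdivision (grid N M) := by
  intro x
  refine ⟨(x.1.take N, x.2.take M), ⟨(mem_grid _ _ _).2 ⟨by simp, by simp⟩,
    ⟨_, embed_take_drop N M x⟩⟩, ?_⟩
  rintro s ⟨hs, w, hw⟩
  exact grid_unique hs ((mem_grid _ _ _).2 ⟨by simp, by simp⟩)
    (hw.trans (embed_take_drop N M x).symm)

/-- A bijection that is affine on every rectangle of a grid is represented by the grid and
its image. -/
lemma isRepresentedBy_of_grid {N M : ℕ} {g : Equiv.Perm Square} {Q : Rect → Prop}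
    (h : ∀ r ∈ grid N M, ∃ v, Q v ∧ ∀ z, g (r.embed z) = v.embed z) :
    ∃ R, (∀ v ∈ R, Q v) ∧ IsRepresentedBy (grid N M) R g := by
  choose v hQ hv using h
  let f : grid N M → Rect := fun r => v r.1 r.2
  have hf : Function.Injective f := by
    intro r s hrs
    have z : Square := (Stream'.const true, Stream'.const true)
    have : r.1.embed z = s.1.embed z := by
      apply g.injective
      rw [hv r.1 r.2, hv s.1 s.2]
      exact congrArg (fun u => Rect.embed u z) hrs
    exact Subtype.ext (grid_unique r.2 s.2 this)
  have hmem : ∀ r, f r ∈ Finset.univ.image f :=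
    fun r => Finset.mem_image_of_mem f (Finset.mem_univ r)
  refine ⟨Finset.univ.image f, ?_, isSubdivision_grid N M, ?_, ?_⟩
  · intro u hu
    obtain ⟨r, -, rfl⟩ := Finset.mem_image.1 hu
    exact hQ _ _
  · intro x
    obtain ⟨r, ⟨hr, z, hz⟩, huniq⟩ := isSubdivision_grid N M (g.symm x)
    refine ⟨f ⟨r, hr⟩, ⟨hmem _, z, ?_⟩, ?_⟩
    · change (v r hr).embed z = x
      rw [← hv, hz, g.apply_symm_apply]
    · rintro u ⟨hu, w, hw⟩
      obtain ⟨s, -, rfl⟩ := Finset.mem_image.1 hu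
      have : s.1 = r := by
        apply huniq
        refine ⟨s.2, w, ?_⟩
        rw [← hw, Equiv.eq_symm_apply]
        exact hv _ _ _
      exact congrArg f (Subtype.ext this)
  · refine ⟨Equiv.ofBijective (fun r => ⟨f r, hmem r⟩) ⟨?_, ?_⟩, ?_⟩
    · intro r s hrs
      exact hf (congrArg Subtype.val hrs)
    · rintro ⟨u, hu⟩
      obtain ⟨r, -, rfl⟩ := Finset.mem_image.1 hu
      exact ⟨r, rfl⟩
    · intro r z
      exact hv _ _ _

lemma prefix_of_append_eq {l a : List Bool} {s t : Stream' Bool}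
    (h : Stream'.appendStream' l s = Stream'.appendStream' a t) (hl : l.length ≤ a.length) :
    ∃ a', a = l ++ a' := by
  have h1 : l = a.take l.length := by
    have := congrArg (Stream'.take l.length) h
    rwa [Stream'.take_append_of_le_length _ _ _ le_rfl,
      Stream'.take_append_of_le_length _ _ _ hl, List.take_length] at this
  exact ⟨a.drop l.length, by
    conv_rhs => lhs; rw [h1]
    exact (List.take_append_drop _ _).symm⟩

lemma affine_on_grid {D R : Finset Rect} {g : Equiv.Perm Square} (h : IsRepresentedBy D R g)
    {N M : ℕ} (hN : ∀ r ∈ D, r.1.length ≤ N) (hM : ∀ r ∈ D, r.2.length ≤ M)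
    {r : Rect} (hr : N ≤ r.1.length ∧ M ≤ r.2.length) :
    ∃ s ∈ R, ∃ t : Rect, t.2.length ≤ r.2.length ∧
      ∀ z, g (r.embed z) = Rect.embed (s.1 ++ t.1, s.2 ++ t.2) z := by
  obtain ⟨hD, -, σ, hσ⟩ := h
  have z : Square := (Stream'.const true, Stream'.const true)
  obtain ⟨u, ⟨hu, w, hw⟩, -⟩ := hD (r.embed z)
  obtain ⟨a', ha⟩ := prefix_of_append_eq (congrArg Prod.fst hw) ((hN u hu).trans hr.1)
  obtain ⟨b', hb⟩ := prefix_of_append_eq (congrArg Prod.snd hw) ((hM u hu).trans hr.2)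
  refine ⟨(σ ⟨u, hu⟩).1, (σ ⟨u, hu⟩).2, (a', b'), by simp [hb], fun z => ?_⟩
  rw [← embed_embed, ← hσ, embed_embed]
  congr 2
  exact Prod.ext ha hb

lemma exists_depth (D : Finset Rect) :
    ∃ N, (∀ r ∈ D, r.1.length ≤ N) ∧ (∀ r ∈ D, r.2.length ≤ N) :=
  ⟨D.sup (fun r => max r.1.length r.2.length),
    fun _ hr => (le_max_left _ _).trans
      (Finset.le_sup (f := fun r : Rect => max r.1.length r.2.length) hr),
    fun _ hr => (le_max_right _ _).trans
      (Finset.le_sup (f := fun r : Rect => max r.1.length r.2.length) hr)⟩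

lemma isRepresentedBy_inv {D R : Finset Rect} {g : Equiv.Perm Square}
    (h : IsRepresentedBy D R g) : IsRepresentedBy R D g⁻¹ := by
  obtain ⟨hD, hR, σ, hσ⟩ := h
  refine ⟨hR, hD, σ.symm, fun r z => ?_⟩
  rw [Equiv.Perm.inv_eq_iff_eq, hσ, Equiv.apply_symm_apply]

lemma exists_split {N M : ℕ} {l : List Bool} (h : N + M ≤ l.length) :
    ∃ a b, l = a ++ b ∧ a.length = N ∧ M ≤ b.length :=
  ⟨l.take N, l.drop N, (List.take_append_drop N l).symm, by simp; omega, by simp; omega⟩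

lemma exists_mul {g h : Equiv.Perm Square}
    (hg : ∃ D R, IsRepresentedBy D R g) (hh : ∃ D R, IsRepresentedBy D R h) :
    ∃ D R, IsRepresentedBy D R (g * h) := by
  obtain ⟨D, R, hD⟩ := hg
  obtain ⟨D', R', hD'⟩ := hh
  obtain ⟨N, hN1, hN2⟩ := exists_depth D
  obtain ⟨M, hM1, hM2⟩ := exists_depth D'
  obtain ⟨R'', -, hR⟩ := isRepresentedBy_of_grid (N := M + N) (M := M + N) (g := g * h)
    (Q := fun _ => True) (by
      intro r hr
      rw [mem_grid] at hr
      obtain ⟨a, a', ha, ha1, ha2⟩ := exists_split hr.1.ge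
      obtain ⟨b, b', hb, hb1, hb2⟩ := exists_split hr.2.ge
      obtain ⟨s, -, t, -, hst⟩ := affine_on_grid hD' hM1 hM2 (r := (a, b)) ⟨ha1.ge, hb1.ge⟩
      obtain ⟨s', -, t', -, hst'⟩ := affine_on_grid hD hN1 hN2
        (r := (s.1 ++ t.1 ++ a', s.2 ++ t.2 ++ b')) ⟨by simp; omega, by simp; omega⟩
      refine ⟨(s'.1 ++ t'.1, s'.2 ++ t'.2), trivial, fun z => ?_⟩
      rw [← hst', Equiv.Perm.mul_apply]
      congr 1
      have : r.embed z = Rect.embed (a, b) (Rect.embed (a', b') z) := by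
        rw [embed_embed]
        congr 2
        exact Prod.ext ha hb
      rw [this, hst, embed_embed])
  exact ⟨_, _, hR⟩

lemma exists_vertical_mul {g h : Equiv.Perm Square}
    (hg : ∃ D R, IsVertical D ∧ IsVertical R ∧ IsRepresentedBy D R g)
    (hh : ∃ D R, IsVertical D ∧ IsVertical R ∧ IsRepresentedBy D R h) :
    ∃ D R, IsVertical D ∧ IsVertical R ∧ IsRepresentedBy D R (g * h) := by
  obtain ⟨D, R, hv, hv2, hD⟩ := hg
  obtain ⟨D', R', hv', hv2', hD'⟩ := hh
  obtain ⟨N, hN1, -⟩ := exists_depth D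
  obtain ⟨M, hM1, -⟩ := exists_depth D'
  obtain ⟨R'', hQ, hR⟩ := isRepresentedBy_of_grid (N := M + N) (M := 0) (g := g * h)
    (Q := fun v => v.2 = []) (by
      intro r hr
      rw [mem_grid] at hr
      obtain ⟨a, a', ha, ha1, ha2⟩ := exists_split hr.1.ge
      have hb : r.2 = [] := List.length_eq_zero_iff.1 hr.2
      obtain ⟨s, hs, t, ht, hst⟩ := affine_on_grid hD' (M := 0) hM1
        (fun r hr => by simp [hv' r hr]) (r := (a, [])) ⟨ha1.ge, le_rfl⟩
      have ht0 : t.2 = [] := List.length_eq_zero_iff.1 (Nat.le_zero.1 ht)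
      have hs0 : s.2 = [] := hv2' s hs
      obtain ⟨s', hs', t', ht', hst'⟩ := affine_on_grid hD (M := 0) hN1
        (fun r hr => by simp [hv r hr])
        (r := (s.1 ++ t.1 ++ a', [])) ⟨by simp; omega, le_rfl⟩
      have ht0' : t'.2 = [] := List.length_eq_zero_iff.1 (Nat.le_zero.1 ht')
      refine ⟨(s'.1 ++ t'.1, s'.2 ++ t'.2), by simp [ht0', hv2 s' hs'], fun z => ?_⟩
      rw [← hst', Equiv.Perm.mul_apply]
      congr 1
      have : r.embed z = Rect.embed (a, []) (Rect.embed (a', []) z) := by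
        rw [embed_embed]
        congr 2
        exact Prod.ext ha hb
      rw [this, hst, embed_embed, ht0, hs0]
      rfl)
  refine ⟨_, _, fun r hr => ?_, hQ, hR⟩
  exact List.length_eq_zero_iff.1 ((mem_grid _ _ _).1 hr).2

lemma isRepresentedBy_one : IsRepresentedBy (grid 0 0) (grid 0 0) 1 :=
  ⟨isSubdivision_grid 0 0, isSubdivision_grid 0 0, Equiv.refl _, fun _ _ => rfl⟩

lemma isVertical_grid (N : ℕ) : IsVertical (grid N 0) :=
  fun _ hr => List.length_eq_zero_iff.1 ((mem_grid _ _ _).1 hr).2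

/-! ### The groups -/

/-- The group `2V`: bijections of the square given by two dyadic subdivisions and a bijection
between their rectangles. -/
def twoV : Subgroup (Equiv.Perm Square) where
  carrier := {g | ∃ D R : Finset Rect, IsRepresentedBy D R g}
  mul_mem' := exists_mul
  one_mem' := ⟨_, _, isRepresentedBy_one⟩
  inv_mem' := by
    rintro g ⟨D, R, h⟩
    exact ⟨R, D, isRepresentedBy_inv h⟩

/-- The vertical copy of `V` in `2V`: the elements which can be given using vertical
subdivisions only. -/
def verticalV : Subgroup twoV where
  carrier := {g | ∃ D R : Finset Rect, IsVertical D ∧ IsVertical R ∧ IsRepresentedBy D R g.1}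
  mul_mem' := exists_vertical_mul
  one_mem' := ⟨_, _, isVertical_grid 0, isVertical_grid 0, isRepresentedBy_one⟩
  inv_mem' := by
    rintro g ⟨D, R, hD, hR, h⟩
    exact ⟨R, D, hR, hD, isRepresentedBy_inv h⟩

/-- The order of the Cantor set (the lexicographic order of binary expansions). -/
def LexLT (x y : Stream' Bool) : Prop :=
  ∃ n, (∀ k < n, x.get k = y.get k) ∧ x.get n = false ∧ y.get n = true

/-- The cyclic order of the Cantor set: `x, y, z` occur in this order when moving to the right
around the circle. -/
def CyclicLT (x y z : Stream' Bool) : Prop :=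
  (LexLT x y ∧ LexLT y z) ∨ (LexLT y z ∧ LexLT z x) ∨ (LexLT z x ∧ LexLT x y)

/-- The vertical copy of `F` in `2V`: the elements of the vertical copy of `V` which preserve
the left-to-right order. -/
def verticalF : Subgroup twoV where
  carrier := {g | g ∈ verticalV ∧
    ∀ p q : Square, LexLT (g.1 p).1 (g.1 q).1 ↔ LexLT p.1 q.1}
  mul_mem' := by
    rintro g h ⟨hg, hg'⟩ ⟨hh, hh'⟩
    exact ⟨mul_mem hg hh, fun p q => (hg' _ _).trans (hh' p q)⟩
  one_mem' := ⟨one_mem _, fun _ _ => Iff.rfl⟩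
  inv_mem' := by
    rintro g ⟨hg, hg'⟩
    refine ⟨inv_mem hg, fun p q => ?_⟩
    rw [← hg']
    change LexLT (g.1 (g.1.symm p)).1 (g.1 (g.1.symm q)).1 ↔ _
    rw [Equiv.apply_symm_apply, Equiv.apply_symm_apply]

/-- The vertical copy of `T` in `2V`: the elements of the vertical copy of `V` which preserve
the left-to-right cyclic order. -/
def verticalT : Subgroup twoV where
  carrier := {g | g ∈ verticalV ∧
    ∀ p q r : Square, CyclicLT (g.1 p).1 (g.1 q).1 (g.1 r).1 ↔ CyclicLT p.1 q.1 r.1}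
  mul_mem' := by
    rintro g h ⟨hg, hg'⟩ ⟨hh, hh'⟩
    exact ⟨mul_mem hg hh, fun p q r => (hg' _ _ _).trans (hh' p q r)⟩
  one_mem' := ⟨one_mem _, fun _ _ _ => Iff.rfl⟩
  inv_mem' := by
    rintro g ⟨hg, hg'⟩
    refine ⟨inv_mem hg, fun p q r => ?_⟩
    rw [← hg']
    change CyclicLT (g.1 (g.1.symm p)).1 (g.1 (g.1.symm q)).1 (g.1 (g.1.symm r)).1 ↔ _
    rw [Equiv.apply_symm_apply, Equiv.apply_symm_apply, Equiv.apply_symm_apply]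

/-! ### The witness -/

/-- The underlying bijection of `C₀`: the left half of the square is mapped affinely onto the
bottom half, the right half onto the top half. -/
def c0Perm : Equiv.Perm Square where
  toFun p := (p.1.tail, Stream'.cons p.1.head p.2)
  invFun p := (Stream'.cons p.2.head p.1, p.2.tail)
  left_inv p := Prod.ext (Stream'.eta p.1) rfl
  right_inv p := Prod.ext rfl (Stream'.eta p.2)

/-- The standard first generator of `F` acting on one coordinate:
`0t ↦ 00t`, `10t ↦ 01t`, `11t ↦ 1t`. -/
def x0Fun (s : Stream' Bool) : Stream' Bool :=
  if s.head = false then Stream'.cons false (Stream'.cons false s.tail)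
  else if s.tail.head = false then Stream'.cons false (Stream'.cons true s.tail.tail)
  else Stream'.cons true s.tail.tail

/-- The inverse of `x0Fun`. -/
def x0Inv (s : Stream' Bool) : Stream' Bool :=
  if s.head = true then Stream'.cons true (Stream'.cons true s.tail)
  else if s.tail.head = false then Stream'.cons false s.tail.tail
  else Stream'.cons true (Stream'.cons false s.tail.tail)

lemma x0Inv_x0Fun (s : Stream' Bool) : x0Inv (x0Fun s) = s := by
  obtain ⟨a, s, rfl⟩ : ∃ a t, s = Stream'.cons a t := ⟨s.head, s.tail, (Stream'.eta s).symm⟩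
  obtain ⟨b, s, rfl⟩ : ∃ b t, s = Stream'.cons b t := ⟨s.head, s.tail, (Stream'.eta s).symm⟩
  cases a <;> cases b <;> simp [x0Inv, x0Fun]

lemma x0Fun_x0Inv (s : Stream' Bool) : x0Fun (x0Inv s) = s := by
  obtain ⟨a, s, rfl⟩ : ∃ a t, s = Stream'.cons a t := ⟨s.head, s.tail, (Stream'.eta s).symm⟩
  obtain ⟨b, s, rfl⟩ : ∃ b t, s = Stream'.cons b t := ⟨s.head, s.tail, (Stream'.eta s).symm⟩
  cases a <;> cases b <;> simp [x0Inv, x0Fun]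

/-- The underlying bijection of `X₀`. -/
def x0Perm : Equiv.Perm Square where
  toFun p := (x0Fun p.1, p.2)
  invFun p := (x0Inv p.1, p.2)
  left_inv p := Prod.ext (x0Inv_x0Fun p.1) rfl
  right_inv p := Prod.ext (x0Fun_x0Inv p.1) rfl

lemma c0Perm_mem : c0Perm ∈ twoV := by
  obtain ⟨R, -, hR⟩ := isRepresentedBy_of_grid (N := 1) (M := 0) (g := c0Perm)
    (Q := fun _ => True) (by
      rintro ⟨a, b⟩ hr
      obtain ⟨ha, hb⟩ := (mem_grid _ _ _).1 hr
      obtain ⟨i, rfl⟩ := List.length_eq_one_iff.1 ha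
      obtain rfl := List.length_eq_zero_iff.1 hb
      exact ⟨([], [i]), trivial, fun z => rfl⟩)
  exact ⟨_, _, hR⟩

lemma x0Perm_mem : x0Perm ∈ twoV := by
  obtain ⟨R, -, hR⟩ := isRepresentedBy_of_grid (N := 2) (M := 0) (g := x0Perm)
    (Q := fun _ => True) (by
      rintro ⟨a, b⟩ hr
      obtain ⟨ha, hb⟩ := (mem_grid _ _ _).1 hr
      obtain ⟨i, j, rfl⟩ := List.length_eq_two.1 ha
      obtain rfl := List.length_eq_zero_iff.1 hb
      cases i
      · exact ⟨([false, false, j], []), trivial, fun z => rfl⟩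
      · cases j
        · exact ⟨([false, true], []), trivial, fun z => rfl⟩
        · exact ⟨([true], []), trivial, fun z => rfl⟩)
  exact ⟨_, _, hR⟩

/-- The generator `C₀` of `2V`. -/
def genC0 : twoV := ⟨c0Perm, c0Perm_mem⟩

/-- The generator `X₀` of `F`, in the vertical copy of `F` in `2V`. -/
def genX0 : twoV := ⟨x0Perm, x0Perm_mem⟩

/-- The witness `C₀⁻ⁿ X₀ C₀ⁿ` (products are compositions, the right factor acting first). -/
def witness (n : ℕ) : twoV := (genC0 ^ n)⁻¹ * genX0 * genC0 ^ n

/-! ### Carets -/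

/-- The leaves of a finite rooted binary tree, from left to right, as dyadic intervals. -/
def treeLeaves : BinaryTree Unit → List (List Bool)
  | .nil => [[]]
  | .node _ l r => (treeLeaves l).map (List.cons false) ++ (treeLeaves r).map (List.cons true)

/-- `(T₊, id, T₋)` is a tree-pair diagram for `g` all of whose carets are vertical: the trees
have the same number of carets, and `g` maps the strip over the `i`-th leaf of the first tree
affinely onto the strip over the `i`-th leaf of the second one. -/
def IsTreePairF (D R : BinaryTree Unit) (g : twoV) : Prop :=
  D.numNodes = R.numNodes ∧ ∀ p ∈ (treeLeaves D).zip (treeLeaves R), ∀ z : Square,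
    g.1 (Rect.embed (p.1, []) z) = Rect.embed (p.2, []) z

/-- The number of carets (in each tree) of a minimal vertical tree-pair diagram of an element of
the vertical copy of `F`; it is `⊤` if there is no such diagram. -/
noncomputable def caretNumberF (g : twoV) : ℕ∞ :=
  ⨅ (D : BinaryTree Unit) (R : BinaryTree Unit) (_ : IsTreePairF D R g), (D.numNodes : ℕ∞)

/-! ### Word length and distortion -/

/-- The word length of `g` with respect to a set `S`: the least length of a word in the elements
of `S` and their inverses with value `g`, and `⊤` if there is no such word. -/
noncomputable def wordLength {G : Type*} [Group G] (S : Set G) (g : G) : ℕ∞ :=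
  ⨅ (l : List G) (_ : (∀ x ∈ l, x ∈ S ∨ x⁻¹ ∈ S) ∧ l.prod = g), (l.length : ℕ∞)

/-- The distortion function of `H` in `G` for generating sets `S` of `G` and `A` of `H`: the
largest `A`-length of an element of `H` whose `S`-length is at most `n`. -/
noncomputable def distortion {G : Type*} [Group G] (H : Subgroup G) (S A : Set G) (n : ℕ) : ℕ∞ :=
  ⨆ (h : G) (_ : h ∈ H ∧ wordLength S h ≤ n), wordLength A h

/-- `H` is at least exponentially distorted in `G`: with respect to any finite generating sets,
the distortion function grows at least exponentially. -/
def IsAtLeastExponentiallyDistorted {G : Type*} [Group G] (H : Subgroup G) : Prop :=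
  ∀ S A : Set G, S.Finite → A.Finite → Subgroup.closure S = ⊤ → Subgroup.closure A = H →
    ∃ a : ℝ, 1 < a ∧ ∀ᶠ n : ℕ in atTop,
      ENNReal.ofReal (a ^ n) ≤ ((distortion H S A n : ℕ∞) : ℝ≥0∞)

/-! ### Word length -/

section WordLength

variable {G : Type*} [Group G]

/-! `C₀ⁿ` moves the first `n` digits of the first coordinate onto the second one, where `X₀` cannot
see them. `X₀` then acts on the remaining digits, and `C₀⁻ⁿ` brings the stored digits back. So a
word of length `2n + 1` performs a copy of `X₀` in each of the `2ⁿ` vertical strips of width `2⁻ⁿ`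
(`witness_apply`).

The lower bounds count the words in `brokenWords g`. The count is subadditive on all of `2V`
(`encard_brokenWords_mul_le`): if `gh` is broken at `u`, then either `h` is broken at `u`, or `h`
carries the strip over `u` to a strip at which `g` is broken, and `u` is determined by that strip.
Elements of the vertical copy of `V` have finite count (`brokenWords_finite`), so a finite set `A`
there has a common bound `C`, and a product of `k` letters has count at most `kC`. Every word of
length at most `n` is broken for the witness (`mem_brokenWords_witness`), which forces `kC ≥ 2ⁿ`.
The same fact puts every leaf of a tree-pair diagram at depth greater than `n`; hanging the diagram
of `X₀` on a complete tree bounds the caret number from above.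

Distortion compares the linear upper bound with the exponential lower bound, after rescaling `n` by
a constant that depends on `S`. -/

lemma wordLength_le_natCast_iff (S : Set G) (g : G) (n : ℕ) :
    wordLength S g ≤ (n : ℕ∞) ↔
      ∃ l : List G, ((∀ x ∈ l, x ∈ S ∨ x⁻¹ ∈ S) ∧ l.prod = g) ∧ l.length ≤ n := by
  constructor
  · intro h
    by_contra! hc
    have h1 : ((n + 1 : ℕ) : ℕ∞) ≤ wordLength S g :=
      le_iInf₂ fun l hl => by exact_mod_cast hc l hl
    have h2 := h1.trans h
    norm_cast at h2
    omega
  · rintro ⟨l, hl, hn⟩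
    exact (iInf₂_le l hl).trans (by exact_mod_cast hn)

lemma wordLength_one_le (S : Set G) : wordLength S (1 : G) ≤ ((0 : ℕ) : ℕ∞) :=
  (wordLength_le_natCast_iff S 1 0).2 ⟨[], ⟨by simp, rfl⟩, le_rfl⟩

lemma wordLength_le_one_of_mem {S : Set G} {g : G} (h : g ∈ S) :
    wordLength S g ≤ ((1 : ℕ) : ℕ∞) :=
  (wordLength_le_natCast_iff S g 1).2 ⟨[g], ⟨by simp [h], by simp⟩, le_rfl⟩

lemma wordLength_mul_le {S : Set G} {g h : G} {m n : ℕ} (hg : wordLength S g ≤ (m : ℕ∞))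
    (hh : wordLength S h ≤ (n : ℕ∞)) : wordLength S (g * h) ≤ ((m + n : ℕ) : ℕ∞) := by
  rw [wordLength_le_natCast_iff] at *
  obtain ⟨l, ⟨hl, rfl⟩, hlm⟩ := hg
  obtain ⟨k, ⟨hk, rfl⟩, hkn⟩ := hh
  refine ⟨l ++ k, ⟨fun x hx => ?_, List.prod_append⟩, by simp; omega⟩
  rcases List.mem_append.1 hx with hx | hx
  exacts [hl x hx, hk x hx]

lemma wordLength_inv_le {S : Set G} {g : G} {n : ℕ} (hg : wordLength S g ≤ (n : ℕ∞)) :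
    wordLength S g⁻¹ ≤ (n : ℕ∞) := by
  rw [wordLength_le_natCast_iff] at *
  obtain ⟨l, ⟨hl, rfl⟩, hln⟩ := hg
  refine ⟨(l.map (·⁻¹)).reverse, ⟨fun x hx => ?_, (List.prod_inv_reverse l).symm⟩, by simpa⟩
  obtain ⟨y, hy, rfl⟩ := List.mem_map.1 (List.mem_reverse.1 hx)
  simpa [or_comm] using hl y hy

lemma wordLength_pow_le {S : Set G} {g : G} {m : ℕ} (hg : wordLength S g ≤ (m : ℕ∞)) (n : ℕ) :
    wordLength S (g ^ n) ≤ ((n * m : ℕ) : ℕ∞) := by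
  induction n with
  | zero => simpa using wordLength_one_le S
  | succ n ih =>
    rw [pow_succ, Nat.succ_mul]
    exact wordLength_mul_le ih hg

lemma exists_wordLength_le {S : Set G} (hS : Subgroup.closure S = ⊤) (g : G) :
    ∃ n : ℕ, wordLength S g ≤ (n : ℕ∞) := by
  have hg : g ∈ Submonoid.closure (S ∪ S⁻¹) := by
    rw [← Subgroup.closure_toSubmonoid, hS]
    trivial
  obtain ⟨l, hl, hg⟩ := Submonoid.exists_list_of_mem_closure hg
  exact ⟨l.length, (wordLength_le_natCast_iff S g _).2 ⟨l, ⟨hl, hg⟩, le_rfl⟩⟩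

end WordLength

lemma wordLength_witness_le {S : Set twoV} {p q : ℕ} (hC : wordLength S genC0 ≤ (p : ℕ∞))
    (hX : wordLength S genX0 ≤ (q : ℕ∞)) (n : ℕ) :
    wordLength S (witness n) ≤ ((2 * n * p + q : ℕ) : ℕ∞) := by
  have h := wordLength_mul_le (wordLength_mul_le (wordLength_inv_le (wordLength_pow_le hC n)) hX)
    (wordLength_pow_le hC n)
  refine h.trans (le_of_eq ?_)
  congr 1
  ring

/-! ### The action of the witness -/

/-- The coordinates behave as two stacks: each application pops a digit from the first and pushes it
on the second, hence the reversal. -/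
lemma genC0_pow_apply (u : List Bool) (x y : Stream' Bool) :
    (genC0 ^ u.length).1 (Stream'.appendStream' u x, y)
      = (x, Stream'.appendStream' u.reverse y) := by
  induction u generalizing y with
  | nil => rfl
  | cons b u ih =>
    rw [List.length_cons, pow_succ]
    change (genC0 ^ u.length).1 (Stream'.appendStream' u x, Stream'.cons b y) = _
    rw [ih, List.reverse_cons, Stream'.append_append_stream]
    rfl

lemma witness_apply (u : List Bool) (x y : Stream' Bool) :
    (witness u.length).1 (Stream'.appendStream' u x, y)
      = (Stream'.appendStream' u (x0Fun x), y) := by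
  have h : (witness u.length).1 (Stream'.appendStream' u x, y)
      = (genC0 ^ u.length).1.symm (x0Perm ((genC0 ^ u.length).1 (Stream'.appendStream' u x, y))) :=
    rfl
  rw [h, Equiv.symm_apply_eq, genC0_pow_apply, genC0_pow_apply]
  rfl

/-! ### The lexicographic order -/

lemma lexLT_cons (a b : Bool) (s t : Stream' Bool) :
    LexLT (Stream'.cons a s) (Stream'.cons b t) ↔
      (a = false ∧ b = true) ∨ (a = b ∧ LexLT s t) := by
  constructor
  · rintro ⟨n, hn, h0, h1⟩
    cases n with
    | zero => exact Or.inl ⟨h0, h1⟩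
    | succ n => exact Or.inr ⟨hn 0 n.succ_pos, n, fun k hk => hn (k + 1) (by omega), h0, h1⟩
  · rintro (⟨rfl, rfl⟩ | ⟨rfl, n, hn, h0, h1⟩)
    · exact ⟨0, by simp, rfl, rfl⟩
    · refine ⟨n + 1, fun k hk => ?_, h0, h1⟩
      cases k with
      | zero => rfl
      | succ k => exact hn k (by omega)

lemma lexLT_x0Fun (s t : Stream' Bool) : LexLT (x0Fun s) (x0Fun t) ↔ LexLT s t := by
  have split : ∀ s : Stream' Bool, ∃ a b r, s = Stream'.cons a (Stream'.cons b r) := fun s =>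
    ⟨s.head, s.tail.head, s.tail.tail, by rw [Stream'.eta, Stream'.eta]⟩
  obtain ⟨a, b, s, rfl⟩ := split s
  obtain ⟨c, d, t, rfl⟩ := split t
  cases a <;> cases b <;> cases c <;> cases d <;> simp [x0Fun, lexLT_cons]

/-- Prefixes of equal length either decide the comparison by themselves or coincide and leave it to
the tails. -/
lemma lexLT_append_congr {s t s' t' : Stream' Bool} (h : LexLT s' t' ↔ LexLT s t) :
    ∀ u v : List Bool, u.length = v.length →
      (LexLT (Stream'.appendStream' u s') (Stream'.appendStream' v t') ↔
        LexLT (Stream'.appendStream' u s) (Stream'.appendStream' v t))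
  | [], [], _ => h
  | a :: u, b :: v, huv => by
    simp only [Stream'.cons_append_stream, lexLT_cons,
      lexLT_append_congr h u v (Nat.succ.inj huv)]

lemma lexLT_witness (n : ℕ) (p q : Square) :
    LexLT ((witness n).1 p).1 ((witness n).1 q).1 ↔ LexLT p.1 q.1 := by
  have key : ∀ p : Square, ∃ u x, u.length = n ∧ p.1 = Stream'.appendStream' u x ∧
      ((witness n).1 p).1 = Stream'.appendStream' u (x0Fun x) := by
    rintro ⟨x, y⟩
    have hl : (x.take n).length = n := Stream'.length_take _ _
    have hx : x = Stream'.appendStream' (x.take n) (x.drop n) :=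
      (Stream'.append_take_drop n x).symm
    refine ⟨x.take n, x.drop n, hl, hx, ?_⟩
    have h := congrArg Prod.fst (witness_apply (x.take n) (x.drop n) y)
    rwa [hl, ← hx] at h
  obtain ⟨u, x, hu, hp, hp'⟩ := key p
  obtain ⟨v, y, hv, hq, hq'⟩ := key q
  rw [hp', hq', hp, hq]
  exact lexLT_append_congr (lexLT_x0Fun x y) u v (hu.trans hv.symm)

lemma witness_mem_verticalV (n : ℕ) : witness n ∈ verticalV := by
  -- `n` digits select the copy of `X₀`, and two more select a branch of `x0Fun`.
  obtain ⟨R, hQ, hR⟩ := isRepresentedBy_of_grid (N := n + 2) (M := 0) (g := (witness n).1)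
    (Q := fun v => v.2 = []) (by
      rintro ⟨a, b⟩ hr
      obtain ⟨ha, hb⟩ := (mem_grid _ _ _).1 hr
      obtain rfl := List.length_eq_zero_iff.1 hb
      obtain ⟨u, w, rfl, rfl, hw⟩ := exists_split ha.ge
      have hw2 : w.length = 2 := by simp at ha; omega
      obtain ⟨i, j, rfl⟩ := List.length_eq_two.1 hw2
      have key : ∀ v, (∀ x, x0Fun (Stream'.appendStream' [i, j] x) = Stream'.appendStream' v x) →
          ∃ v : Rect, v.2 = [] ∧ ∀ z, (witness u.length).1 (Rect.embed (u ++ [i, j], []) z)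
            = v.embed z := fun v hv => ⟨(u ++ v, []), rfl, fun z => by
        simp only [Rect.embed, Stream'.append_append_stream, ← hv]
        exact witness_apply u _ _⟩
      cases i
      · exact key [false, false, j] fun x => rfl
      · cases j
        · exact key [false, true] fun x => rfl
        · exact key [true] fun x => rfl)
  exact ⟨_, R, isVertical_grid _, hQ, hR⟩

lemma witness_mem_verticalF (n : ℕ) : witness n ∈ verticalF :=
  ⟨witness_mem_verticalV n, lexLT_witness n⟩

lemma verticalF_le_verticalT : verticalF ≤ verticalT := by
  rintro g ⟨hg, h⟩
  exact ⟨hg, fun p q r => by simp only [CyclicLT, h]⟩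

lemma verticalT_le_verticalV : verticalT ≤ verticalV := fun _ hg => hg.1

/-! ### Strips on which an element is not affine -/

/-- The words `u` such that `g` does not map the strip over `u` affinely onto another strip. -/
def brokenWords (g : twoV) : Set (List Bool) :=
  {u | ¬∃ v, ∀ z : Square, g.1 (Rect.embed (u, []) z) = Rect.embed (v, []) z}

lemma not_forall_cons_append_eq (b : Bool) (a : List Bool) {f : Stream' Bool → Stream' Bool}
    (hf : Function.Surjective f) :
    ¬∀ x, Stream'.appendStream' (b :: a) x = f x := by
  intro h
  obtain ⟨x, hx⟩ := hf (Stream'.const !b)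
  have h1 := congrArg Stream'.head ((h x).trans hx)
  rw [Stream'.cons_append_stream, Stream'.head_cons] at h1
  change b = !b at h1
  simp at h1

/-- One word is a prefix of the other; a surplus letter would force either every value of `f` or
every stream to begin with that letter. Taking `f = x0Fun` shows that strips are broken; taking `f =
id` shows that a strip determines its word. -/
lemma append_surjective_eq {u w : List Bool} {f : Stream' Bool → Stream' Bool}
    (hf : Function.Surjective f)
    (h : ∀ x, Stream'.appendStream' u (f x) = Stream'.appendStream' w x) : u = w ∧ f = id := by
  rcases le_total u.length w.length with hl | hl
  · obtain ⟨a, rfl⟩ := prefix_of_append_eq (h (Stream'.const true)) hl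
    have h' : ∀ x, Stream'.appendStream' a x = f x := fun x =>
      Stream'.append_right_injective u _ _ (by rw [h, Stream'.append_append_stream])
    cases a with
    | nil => exact ⟨by simp, funext fun x => (h' x).symm⟩
    | cons b a => exact absurd h' (not_forall_cons_append_eq b a hf)
  · obtain ⟨a, rfl⟩ := prefix_of_append_eq (h (Stream'.const true)).symm hl
    have h' : ∀ x, Stream'.appendStream' a (f x) = x := fun x =>
      Stream'.append_right_injective w _ _ (by rw [← Stream'.append_append_stream, h])
    cases a with
    | nil => exact ⟨by simp, funext h'⟩
    | cons b a =>
      have h0 := h' (Stream'.const !b)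
      rw [Stream'.cons_append_stream] at h0
      have h1 : b = !b := congrArg Stream'.head h0
      simp at h1

lemma mem_brokenWords_witness {u : List Bool} {n : ℕ} (hu : u.length ≤ n) :
    u ∈ brokenWords (witness n) := by
  rintro ⟨v, hv⟩
  -- An affine map on the strip over `u` stays affine on any substrip, so it suffices to refute this
  -- at depth exactly `n`, where `witness_apply` is available.
  let w := u ++ List.replicate (n - u.length) true
  have hw : w.length = n := by simp [w, hu]
  have h : ∀ x, Stream'.appendStream' w (x0Fun x)
      = Stream'.appendStream' (v ++ List.replicate (n - u.length) true) x := fun x => by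
    have h1 := witness_apply w x x
    rw [hw, Stream'.append_append_stream] at h1
    rw [Stream'.append_append_stream v]
    exact congrArg Prod.fst (h1.symm.trans
      (hv (Stream'.appendStream' (List.replicate (n - u.length) true) x, x)))
  have hid := (append_surjective_eq (fun x => ⟨x0Inv x, x0Fun_x0Inv x⟩) h).2
  -- `x0Fun` is not the identity: it sends `1000…` to `01000…`.
  have hx := congrArg (fun s : Stream' Bool => s.head)
    (congrFun hid (Stream'.cons true (Stream'.const false)))
  exact Bool.false_ne_true hx

lemma encard_brokenWords_mul_le (g h : twoV) :
    (brokenWords (g * h)).encard ≤ (brokenWords g).encard + (brokenWords h).encard := by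
  let T : Set (List Bool) :=
    {u | ∃ v ∈ brokenWords g, ∀ z : Square, h.1 (Rect.embed (u, []) z) = Rect.embed (v, []) z}
  have hsub : brokenWords (g * h) ⊆ T ∪ brokenWords h := by
    intro u hu
    by_cases hh : u ∈ brokenWords h
    · exact Or.inr hh
    · obtain ⟨v, hv⟩ := not_not.1 hh
      refine Or.inl ⟨v, fun ⟨w, hw⟩ => hu ⟨w, fun z => ?_⟩, hv⟩
      rw [← hw, ← hv]
      rfl
  have hT : T.encard ≤ (brokenWords g).encard := by
    have hex : ∀ u ∈ T, ∃ v, v ∈ brokenWords g ∧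
        ∀ z : Square, h.1 (Rect.embed (u, []) z) = Rect.embed (v, []) z := fun u hu => hu
    choose! f hf using hex
    refine Set.encard_le_encard_of_injOn (f := f) (fun u hu => (hf u hu).1) fun u hu w hw huw => ?_
    refine (append_surjective_eq (f := id) Function.surjective_id fun x => ?_).1
    refine congrArg Prod.fst (h.1.injective (a₁ := Rect.embed (u, []) (x, x))
      (a₂ := Rect.embed (w, []) (x, x)) ?_)
    rw [(hf u hu).2, (hf w hw).2, huw]
  exact (Set.encard_le_encard hsub).trans ((Set.encard_union_le _ _).trans (by gcongr))

/-- A strip at least as deep as every strip of the domain subdivision lies inside one of them, so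
broken words have bounded length. -/
lemma brokenWords_finite {g : twoV} (hg : g ∈ verticalV) : (brokenWords g).Finite := by
  obtain ⟨D, R, hD, hR, h⟩ := hg
  obtain ⟨N, hN, -⟩ := exists_depth D
  refine (List.finite_length_le Bool N).subset fun u hu => ?_
  by_contra hl
  obtain ⟨s, hs, t, ht, hst⟩ := affine_on_grid h (M := 0) hN (fun r hr => by simp [hD r hr])
    (r := (u, [])) ⟨(not_le.1 hl).le, le_rfl⟩
  refine hu ⟨s.1 ++ t.1, fun z => ?_⟩
  rw [hst, hR s hs, List.length_eq_zero_iff.1 (Nat.le_zero.1 ht)]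
  rfl

lemma two_pow_le_encard_brokenWords_witness (n : ℕ) :
    ((2 ^ n : ℕ) : ℕ∞) ≤ (brokenWords (witness n)).encard := by
  have hinj : Function.Injective (List.ofFn : (Fin n → Bool) → List Bool) := List.ofFn_injective
  calc ((2 ^ n : ℕ) : ℕ∞)
      = (Set.range (List.ofFn : (Fin n → Bool) → List Bool)).encard := by
        rw [← Set.image_univ, hinj.encard_image, Set.encard_univ]
        simp
    _ ≤ _ := Set.encard_le_encard <| by
        rintro _ ⟨f, rfl⟩
        exact mem_brokenWords_witness (by simp)

lemma encard_brokenWords_prod_le {C : ℕ∞} (l : List twoV)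
    (h : ∀ x ∈ l, (brokenWords x).encard ≤ C) :
    (brokenWords l.prod).encard ≤ l.length * C := by
  induction l with
  | nil =>
    have : brokenWords 1 = ∅ :=
      Set.eq_empty_of_forall_notMem fun u hu => hu ⟨u, fun z => rfl⟩
    simp [this]
  | cons g l ih =>
    rw [List.prod_cons, List.length_cons, Nat.cast_succ, add_mul, one_mul, add_comm]
    refine (encard_brokenWords_mul_le _ _).trans (add_le_add (h g (by simp)) ?_)
    exact ih fun x hx => h x (by simp [hx])

lemma exists_le_wordLength_witness {A : Set twoV} (hA : A.Finite) (hAV : A ⊆ verticalV) :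
    ∃ c : ℝ, 0 < c ∧ ∀ n : ℕ,
      ENNReal.ofReal (c * 2 ^ n) ≤ ((wordLength A (witness n) : ℕ∞) : ℝ≥0∞) := by
  obtain ⟨C, hC0, hC⟩ : ∃ C : ℕ, 0 < C ∧
      ∀ x, x ∈ A ∨ x⁻¹ ∈ A → (brokenWords x).encard ≤ (C : ℕ∞) := by
    have hfin : (A ∪ A⁻¹).Finite := hA.union hA.inv
    -- The sum dominates each of its terms; the extra `1` keeps `C` positive, so that `1 / C` can
    -- serve as the constant.
    refine ⟨∑ x ∈ hfin.toFinset, (brokenWords x).ncard + 1, by omega, fun x hx => ?_⟩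
    have hxV : x ∈ verticalV := hx.elim (fun h => hAV h) fun h => inv_mem_iff.1 (hAV h)
    rw [← (brokenWords_finite hxV).cast_ncard_eq]
    have := Finset.single_le_sum (f := fun x => (brokenWords x).ncard) (fun _ _ => Nat.zero_le _)
      (hfin.mem_toFinset.2 hx : x ∈ hfin.toFinset)
    exact_mod_cast this.trans (Nat.le_succ _)
  refine ⟨1 / C, by positivity, fun n => ?_⟩
  rcases eq_or_ne (wordLength A (witness n)) ⊤ with htop | htop
  · simp [htop]
  obtain ⟨k, hk⟩ := ENat.ne_top_iff_exists.1 htop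
  obtain ⟨l, ⟨hl, hprod⟩, hlk⟩ := (wordLength_le_natCast_iff A (witness n) k).1 hk.symm.le
  have h1 := (two_pow_le_encard_brokenWords_witness n).trans
    (hprod ▸ encard_brokenWords_prod_le l fun x hx => hC x (hl x hx))
  have h2 : 2 ^ n ≤ k * C := by
    norm_cast at h1
    exact h1.trans (Nat.mul_le_mul_right C hlk)
  rw [← hk, ENat.toENNReal_coe, ← ENNReal.ofReal_natCast]
  refine ENNReal.ofReal_le_ofReal ?_
  rw [one_div_mul_eq_div, div_le_iff₀ (by positivity)]
  exact_mod_cast h2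

/-! ### Carets -/

lemma length_treeLeaves (t : BinaryTree Unit) : (treeLeaves t).length = t.numNodes + 1 := by
  induction t with
  | nil => rfl
  | node _ l r hl hr => simp [treeLeaves, BinaryTree.numNodes, hl, hr]; omega

/-- Such a tree contains the complete tree of depth `m`; the right-hand side is its number of
leaves. -/
lemma two_pow_le_of_le_length {m : ℕ} : ∀ {t : BinaryTree Unit},
    (∀ p ∈ treeLeaves t, m ≤ p.length) → 2 ^ m ≤ t.numNodes + 1 := by
  induction m with
  | zero => simp
  | succ m ih =>
    rintro (_ | ⟨_, l, r⟩) h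
    · simpa using h [] (by simp [treeLeaves])
    · have hl : 2 ^ m ≤ l.numNodes + 1 := ih fun p hp => by
        simpa using h (false :: p) (by simp [treeLeaves, hp])
      have hr : 2 ^ m ≤ r.numNodes + 1 := ih fun p hp => by
        simpa using h (true :: p) (by simp [treeLeaves, hp])
      simp only [BinaryTree.numNodes, pow_succ]
      omega

lemma two_pow_le_caretNumberF_witness (n : ℕ) :
    ((2 ^ n : ℕ) : ℕ∞) ≤ caretNumberF (witness n) := by
  refine le_iInf fun D => le_iInf fun R => le_iInf fun h => ?_
  have hleaf : ∀ p ∈ treeLeaves D, n + 1 ≤ p.length := by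
    intro p hp
    by_contra hlt
    refine mem_brokenWords_witness (u := p) (n := n) (by omega) ?_
    obtain ⟨i, hi, rfl⟩ := List.mem_iff_getElem.1 hp
    -- Equal caret numbers ensure that `zip` drops no leaf of `D`.
    have hi' : i < (treeLeaves R).length := by
      rw [length_treeLeaves] at hi ⊢
      have := h.1
      omega
    refine ⟨(treeLeaves R)[i], h.2 ((treeLeaves D)[i], (treeLeaves R)[i]) ?_⟩
    rw [List.mem_iff_getElem]
    exact ⟨i, by simp [hi, hi'], by simp⟩
  have := two_pow_le_of_le_length hleaf
  have hpos : 0 < 2 ^ n := by positivity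
  rw [pow_succ] at this
  exact_mod_cast (by omega : 2 ^ n ≤ D.numNodes)

/-- The complete binary tree of depth `n` with a copy of `t` hanging at every leaf. -/
def graft (t : BinaryTree Unit) : ℕ → BinaryTree Unit
  | 0 => t
  | n + 1 => .node () (graft t n) (graft t n)

lemma numNodes_graft (t : BinaryTree Unit) (n : ℕ) :
    (graft t n).numNodes + 1 = 2 ^ n * (t.numNodes + 1) := by
  induction n with
  | zero => simp [graft]
  | succ n ih =>
    rw [pow_succ, mul_right_comm, ← ih, graft, BinaryTree.numNodes]
    ring

/-- Equal caret numbers keep the leaf lists aligned: at each level left halves are paired with left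
halves and right with right. -/
lemma exists_of_mem_zip_graft {s t : BinaryTree Unit} (h : s.numNodes = t.numNodes) (n : ℕ) :
    ∀ p ∈ (treeLeaves (graft s n)).zip (treeLeaves (graft t n)),
      ∃ u : List Bool, u.length = n ∧
        ∃ q ∈ (treeLeaves s).zip (treeLeaves t), p = (u ++ q.1, u ++ q.2) := by
  induction n with
  | zero => exact fun p hp => ⟨[], rfl, p, hp, rfl⟩
  | succ n ih =>
    intro p hp
    have hn : (graft s n).numNodes = (graft t n).numNodes :=
      Nat.succ.inj (by rw [Nat.succ_eq_add_one, Nat.succ_eq_add_one, numNodes_graft,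
        numNodes_graft, h])
    rw [graft, graft, treeLeaves, treeLeaves,
      List.zip_append (by simp [length_treeLeaves, hn]), List.zip_map, List.zip_map,
      List.mem_append, List.mem_map, List.mem_map] at hp
    obtain ⟨r, hr, rfl⟩ | ⟨r, hr, rfl⟩ := hp
    · obtain ⟨u, hu, q, hq, rfl⟩ := ih r hr
      exact ⟨false :: u, by simp [hu], q, hq, rfl⟩
    · obtain ⟨u, hu, q, hq, rfl⟩ := ih r hr
      exact ⟨true :: u, by simp [hu], q, hq, rfl⟩

lemma caretNumberF_witness_le (n : ℕ) :
    caretNumberF (witness n) ≤ ((3 * 2 ^ n : ℕ) : ℕ∞) := by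
  -- The diagram of `X₀`: leaves `0, 10, 11` go to `00, 01, 1`.
  let D : BinaryTree Unit := .node () .nil (.node () .nil .nil)
  let R : BinaryTree Unit := .node () (.node () .nil .nil) .nil
  have hcard : ∀ t : BinaryTree Unit, t.numNodes = 2 → (graft t n).numNodes = 2 ^ n * 3 - 1 :=
    fun t ht => by
      have := numNodes_graft t n
      rw [ht] at this
      omega
  have hpair : IsTreePairF (graft D n) (graft R n) (witness n) := by
    refine ⟨by rw [hcard D rfl, hcard R rfl], fun p hp z => ?_⟩
    obtain ⟨u, rfl, q, hq, rfl⟩ := exists_of_mem_zip_graft (s := D) (t := R) rfl n p hp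
    have hx0 : ∀ x, x0Fun (Stream'.appendStream' q.1 x) = Stream'.appendStream' q.2 x := by
      intro x
      simp only [D, R, treeLeaves, List.map_cons, List.map_nil, List.cons_append, List.nil_append,
        List.zip_cons_cons, List.zip_nil_left, List.mem_cons, List.not_mem_nil, or_false] at hq
      rcases hq with rfl | rfl | rfl <;> rfl
    simp only [Rect.embed, Stream'.append_append_stream, ← hx0]
    exact witness_apply u _ _
  refine (iInf_le_of_le (graft D n) <| iInf_le_of_le (graft R n) <| iInf_le _ hpair).trans ?_
  rw [hcard D rfl]
  exact_mod_cast (by omega : 2 ^ n * 3 - 1 ≤ 3 * 2 ^ n)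

/-! ### Distortion -/

lemma exists_eventually_pow_le (K : ℕ) (hK : 0 < K) {c : ℝ} (hc : 0 < c) :
    ∃ a : ℝ, 1 < a ∧ ∀ᶠ n : ℕ in atTop, a ^ n ≤ c * 2 ^ (n / K) := by
  have hb : (1 : ℝ) < √2 := Real.lt_sqrt_of_sq_lt (by norm_num)
  have hb2 : √2 * √2 = (2 : ℝ) := Real.mul_self_sqrt (by norm_num)
  -- With base `√2` in place of `2`, a spare factor `√2 ^ (n / K)` remains; for large `n` it absorbs
  -- both `c` and the factor `√2` lost by rounding `n / K` down.
  have ha : (1 : ℝ) < √2 ^ ((K : ℝ)⁻¹) := Real.one_lt_rpow hb (by positivity)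
  refine ⟨_, ha, ?_⟩
  have hlim : Tendsto (fun n : ℕ => √2 ^ (n / K)) atTop atTop :=
    (tendsto_pow_atTop_atTop_of_one_lt hb).comp (Nat.tendsto_div_const_atTop hK.ne')
  filter_upwards [hlim.eventually_ge_atTop (√2 / c)] with n hn
  have hn' : √2 ≤ c * √2 ^ (n / K) := by rwa [div_le_iff₀' hc] at hn
  calc (√2 ^ ((K : ℝ)⁻¹)) ^ n ≤ (√2 ^ ((K : ℝ)⁻¹)) ^ (K * (n / K + 1)) :=
        pow_le_pow_right₀ ha.le (Nat.lt_mul_div_succ n hK).le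
    _ = √2 * √2 ^ (n / K) := by
        rw [pow_mul, Real.rpow_inv_natCast_pow (by positivity) hK.ne', pow_succ, mul_comm]
    _ ≤ c * √2 ^ (n / K) * √2 ^ (n / K) := by gcongr
    _ = c * 2 ^ (n / K) := by rw [mul_assoc, ← mul_pow, hb2]

lemma isAtLeastExponentiallyDistorted_of_le {H : Subgroup twoV} (hF : verticalF ≤ H)
    (hV : H ≤ verticalV) : IsAtLeastExponentiallyDistorted H := by
  intro S A _ hA hS hAH
  have hAV : A ⊆ verticalV := fun x hx => hV (hAH ▸ Subgroup.subset_closure hx)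
  obtain ⟨c, hc, hlow⟩ := exists_le_wordLength_witness hA hAV
  obtain ⟨p, hp⟩ := exists_wordLength_le hS genC0
  obtain ⟨q, hq⟩ := exists_wordLength_le hS genX0
  -- Chosen so that `2mp + q ≤ mK` for every `m ≥ 1`; with `m = n / K` the witness then has
  -- `S`-length at most `n`. The final `1` makes `K` positive even if `p = q = 0`.
  let K := 2 * p + q + 1
  have hK : 0 < K := by positivity
  obtain ⟨a, ha, hev⟩ := exists_eventually_pow_le K hK hc
  refine ⟨a, ha, ?_⟩
  filter_upwards [hev, eventually_ge_atTop K] with n hn hnK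
  have hword : wordLength S (witness (n / K)) ≤ n := by
    refine (wordLength_witness_le hp hq (n / K)).trans ?_
    have h1 : 1 ≤ n / K := (Nat.one_le_div_iff hK).2 hnK
    have h2 : n / K * K ≤ n := Nat.div_mul_le_self n K
    have h3 : 2 * (n / K) * p + q ≤ n / K * K := by
      have : q ≤ n / K * q := Nat.le_mul_of_pos_left q h1
      calc 2 * (n / K) * p + q ≤ 2 * (n / K) * p + n / K * q + n / K := by omega
        _ = n / K * K := by simp only [K]; ring
    exact_mod_cast h3.trans h2
  calc ENNReal.ofReal (a ^ n) ≤ ENNReal.ofReal (c * 2 ^ (n / K)) := ENNReal.ofReal_le_ofReal hn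
    _ ≤ ((wordLength A (witness (n / K)) : ℕ∞) : ℝ≥0∞) := hlow _
    _ ≤ ((distortion H S A n : ℕ∞) : ℝ≥0∞) := by
        refine ENat.toENNReal_le.2 ?_
        exact le_iSup₂_of_le (witness (n / K)) ⟨hF (witness_mem_verticalF _), hword⟩ le_rfl

theorem theorem5p1 :
    (IsAtLeastExponentiallyDistorted verticalF ∧
      IsAtLeastExponentiallyDistorted verticalT ∧
      IsAtLeastExponentiallyDistorted verticalV) ∧
    (∀ n : ℕ,
      (∀ S : Set twoV, genC0 ∈ S → genX0 ∈ S →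
        wordLength S (witness n) ≤ ((2 * n + 1 : ℕ) : ℕ∞)) ∧
      witness n ∈ verticalF ∧
      ((2 ^ n : ℕ) : ℕ∞) ≤ caretNumberF (witness n) ∧
      caretNumberF (witness n) ≤ ((3 * 2 ^ n : ℕ) : ℕ∞)) ∧
    (∀ A : Set twoV, A.Finite → A ⊆ verticalV →
      ∃ c : ℝ, 0 < c ∧ ∀ n : ℕ,
        ENNReal.ofReal (c * 2 ^ n) ≤ ((wordLength A (witness n) : ℕ∞) : ℝ≥0∞)) := by
  have hFV := verticalF_le_verticalT.trans verticalT_le_verticalV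
  refine ⟨⟨isAtLeastExponentiallyDistorted_of_le le_rfl hFV,
    isAtLeastExponentiallyDistorted_of_le verticalF_le_verticalT verticalT_le_verticalV,
    isAtLeastExponentiallyDistorted_of_le hFV le_rfl⟩, fun n => ⟨fun S hC hX => ?_,
    witness_mem_verticalF n, two_pow_le_caretNumberF_witness n, caretNumberF_witness_le n⟩,
    fun A hA hAV => exists_le_wordLength_witness hA hAV⟩
  simpa using wordLength_witness_le (wordLength_le_one_of_mem hC) (wordLength_le_one_of_mem hX) n
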